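/- Let $\nu>-1$ be real, let $m,n\ge 0$ be integers, and put $k=\min(m,n)$. Let $\mathbb D$ be the unit disk of $\mathbb R^2$ with the weight $$w_\nu(\mathbf x)=\frac{\nu+1}{\pi}\,(1-\|\mathbf x\|^2)^{\nu},$$ and let $D^\nu_{m,n}$ be the disk polynomial $$D^\nu_{m,n}(r\cos\theta,r\sin\theta)=\frac{(-1)^{k}\,k!}{(\nu+1)_{k}}\;e^{i(m-n)\theta}\,r^{|m-n|}\,P_{k}^{(|m-n|,\nu)}(1-2r^2),$$ where $(a)_k=a(a+1)\cdots(a+k-1)$ and $P_k^{(\alpha,\beta)}(x)=\binom{\alpha+k}{k}\,{}_2F_1\!\left(-k,k+\alpha+\beta+1;\alpha+1;\tfrac{1-x}{2}\right)$ is the Jacobi polynomial. Let $J_\mu$ denote the Bessel function of the first kind of order $\mu$. Then for every $\mathbf y=(\rho\cos\vartheta,\rho\sin\vartheta)$ with $\rho>0$ and $\vartheta\in\mathbb R$, the function $\mathbf x\mapsto D^\nu_{m,n}(\mathbf x)\,e^{i\langle \mathbf x,\mathbf y\rangle}\,w_\nu(\mathbf x)$ is integrable on $\mathbb D$ and $$\int_{\mathbb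 D} D^\nu_{m,n}(\mathbf x)\,e^{i\langle \mathbf x,\mathbf y\rangle}\,w_\nu(\mathbf x)\,d\mathbf x = c_{n,m}(\nu)\left(\frac{2}{\rho}\right)^{\nu+1}J_{\nu+n+m+1}(\rho)\,e^{i(m-n)\vartheta},$$ where $$c_{n,m}(\nu)=(-1)^m(\nu+1)\,i^{\,n-m}\,\Gamma(\nu+1).$$ -/

import Mathlib

noncomputable section

/-- The Bessel function of the first kind `J_μ(x)` of real order `μ` at `x > 0`:
`∑ k, (-1)^k / (k! Γ(μ + k + 1)) (x / 2)^(2 k + μ)`. Mathlib's `Real.Gamma` vanishes at its poles, so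
`1 / Γ` is zero there, as usual. -/
def besselJ (μ x : ℝ) : ℝ :=
  ∑' k : ℕ, (-1 : ℝ) ^ k / ((k.factorial : ℝ) * Real.Gamma (μ + k + 1)) *
    (x / 2) ^ (2 * (k : ℝ) + μ)

/-- The Jacobi polynomial `P_n^{(α, β)}(x) = binom(α + n, n) ₂F₁(-n, n + α + β + 1; α + 1; (1 - x) / 2)`
for `α > -1`; here `binom(α + n, n) = (α + 1)_n / n!`, with `(a)_n` the rising factorial. -/
def jacobiP (n : ℕ) (α β x : ℝ) : ℝ :=
  (ascPochhammer ℝ n).eval (α + 1) / (n.factorial : ℝ) *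
    ordinaryHypergeometric (-(n : ℝ)) ((n : ℝ) + α + β + 1) (α + 1) ((1 - x) / 2)

/-- The weight `w_ν(x) = (ν + 1) / π (1 - |x|²)^ν` on the unit disk. -/
def diskWeight (ν : ℝ) (x : EuclideanSpace ℝ (Fin 2)) : ℝ :=
  (ν + 1) / Real.pi * (1 - ‖x‖ ^ 2) ^ ν

/-- A polar angle of the point `x` of the plane. -/
def polarAngle (x : EuclideanSpace ℝ (Fin 2)) : ℝ :=
  Complex.arg ((x 0 : ℂ) + (x 1 : ℂ) * Complex.I)

/-- The disk polynomial `D^ν_{m,n}(x)`: at the point with polar coordinates `(r, θ)` it is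
`(-1)^k (k! / (ν + 1)_k) e^{i (m - n) θ} r^{|m - n|} P_k^{(|m - n|, ν)}(1 - 2 r²)`, `k = min m n`.
(The value does not depend on the angle chosen; see `diskPoly_polar`.) -/
def diskPoly (ν : ℝ) (m n : ℕ) (x : EuclideanSpace ℝ (Fin 2)) : ℂ :=
  (((-1 : ℝ) ^ min m n * ((min m n).factorial : ℝ) / (ascPochhammer ℝ (min m n)).eval (ν + 1) : ℝ) : ℂ) *
    Complex.exp (Complex.I * ((m : ℂ) - (n : ℂ)) * (polarAngle x : ℂ)) *
    ((‖x‖ ^ ((m : ℤ) - (n : ℤ)).natAbs *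
      jacobiP (min m n) (((m : ℤ) - (n : ℤ)).natAbs : ℝ) ν (1 - 2 * ‖x‖ ^ 2) : ℝ) : ℂ)

theorem diskPoly_polar (ν : ℝ) (m n : ℕ) (r θ : ℝ) (hr : 0 ≤ r) :
    diskPoly ν m n !₂[r * Real.cos θ, r * Real.sin θ] =
      (((-1 : ℝ) ^ min m n * ((min m n).factorial : ℝ) / (ascPochhammer ℝ (min m n)).eval (ν + 1) : ℝ) : ℂ) *
        Complex.exp (Complex.I * ((m : ℂ) - (n : ℂ)) * (θ : ℂ)) *
        ((r ^ ((m : ℤ) - (n : ℤ)).natAbs *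
          jacobiP (min m n) (((m : ℤ) - (n : ℤ)).natAbs : ℝ) ν (1 - 2 * r ^ 2) : ℝ) : ℂ) := by
  have hnorm : ‖(!₂[r * Real.cos θ, r * Real.sin θ] : EuclideanSpace ℝ (Fin 2))‖ = r := by
    rw [EuclideanSpace.norm_eq, Real.sqrt_eq_iff_mul_self_eq (by positivity) hr]
    simp only [Fin.sum_univ_two, Real.norm_eq_abs, sq_abs]
    simp
    nlinarith [Real.sin_sq_add_cos_sq θ]
  unfold diskPoly
  rw [hnorm]
  rcases hr.eq_or_lt with h0 | hpos
  · subst h0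
    by_cases hmn : m = n
    · subst hmn
      simp
    · have : ((m : ℤ) - (n : ℤ)).natAbs ≠ 0 := by omega
      simp [this]
  · congr 2
    have hz : (((!₂[r * Real.cos θ, r * Real.sin θ] : EuclideanSpace ℝ (Fin 2)) 0 : ℝ) : ℂ) +
        (((!₂[r * Real.cos θ, r * Real.sin θ] : EuclideanSpace ℝ (Fin 2)) 1 : ℝ) : ℂ) * Complex.I =
        (r : ℂ) * (Complex.cos (θ : ℂ) + Complex.sin (θ : ℂ) * Complex.I) := by
      simp
      ring
    have ha : Complex.exp (Complex.I *
        (polarAngle !₂[r * Real.cos θ, r * Real.sin θ] : ℂ)) = Complex.exp (Complex.I * (θ : ℂ)) := by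
      unfold polarAngle
      rw [hz]
      have h := Complex.norm_mul_exp_arg_mul_I
        ((r : ℂ) * (Complex.cos (θ : ℂ) + Complex.sin (θ : ℂ) * Complex.I))
      have hn : ‖(r : ℂ) * (Complex.cos (θ : ℂ) + Complex.sin (θ : ℂ) * Complex.I)‖ = r := by
        rw [norm_mul, Complex.norm_cos_add_sin_mul_I, mul_one, Complex.norm_real,
          Real.norm_of_nonneg hr]
      rw [hn] at h
      have h2 := mul_left_cancel₀ (Complex.ofReal_ne_zero.mpr hpos.ne') h
      rw [mul_comm, h2, mul_comm Complex.I, Complex.exp_mul_I]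
    have key : ∀ t : ℂ, Complex.exp (Complex.I * ((m : ℂ) - (n : ℂ)) * t) =
        Complex.exp (Complex.I * t) ^ ((m : ℤ) - (n : ℤ)) := by
      intro t
      rw [← Complex.exp_int_mul]
      congr 1
      push_cast
      ring
    rw [key, key, ha]

/-- The constant `c_{n,m}(ν) = (-1)^m (ν + 1) i^{n - m} Γ(ν + 1)`. -/
def diskConst (ν : ℝ) (m n : ℕ) : ℂ :=
  (-1 : ℂ) ^ m * ((ν : ℂ) + 1) * Complex.I ^ ((n : ℤ) - (m : ℤ)) * (Real.Gamma (ν + 1) : ℂ)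

end

open MeasureTheory Set

/-! Expand the plane wave in its exponential series and integrate term by term. In polar coordinates
the `p`-th term splits into an angular and a radial integral. With `l = m - n`, `a = |l|`, `k = min
m n`, the angular integral of `e^{ilθ} cos(θ - ϑ)^p` vanishes unless `p = a + 2j`
(`integral_exp_mul_cos_pow`). The radial integral is then a moment of a Jacobi polynomial, a
terminating `₃F₂` at 1 that Pfaff–Saalschütz sums to a multiple of `(-j)_k`
(`integral_pow_mul_jacobiP`), hence zero for `j < k`.

Since `a + 2k = m + n`, only `p = m + n + 2q` survives; there the factorials cancel and leave the
`q`-th term of the Bessel series of order `ν + n + m + 1`, up to the power `(2/ρ)^(ν+1)`. -/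

/-! ### Pochhammer symbols and the Pfaff–Saalschütz sum. -/

theorem ascPochhammer_eval_succ_left {R : Type*} [CommSemiring R] (n : ℕ) (x : R) :
    (ascPochhammer R (n + 1)).eval x = x * (ascPochhammer R n).eval (x + 1) := by
  simp [ascPochhammer_succ_left]

/-- Telescoped form of the contiguous relation behind the Pfaff–Saalschütz theorem. -/
theorem saalschutz_telescope (k b c β : ℝ) (hb : 0 < b) (hd : 0 < b + c - β) (N : ℕ) :
    ∑ s ∈ Finset.range (N + 1),
      ((ascPochhammer ℝ s).eval (-k) * (ascPochhammer ℝ s).eval (k + b + c - 1) *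
          (ascPochhammer ℝ s).eval (b - β) /
        (s.factorial * (ascPochhammer ℝ s).eval b * (ascPochhammer ℝ s).eval (b + c - β)) -
      c * β / (b * (b + c - β)) *
        ((ascPochhammer ℝ s).eval (-k + 1) * (ascPochhammer ℝ s).eval (k + b + c) *
          (ascPochhammer ℝ s).eval (b - β) /
        (s.factorial * (ascPochhammer ℝ s).eval (b + 1) *
          (ascPochhammer ℝ s).eval (b + c - β + 1)))) =
    ((N : ℝ) + b + c) * (ascPochhammer ℝ N).eval (-k + 1) * (ascPochhammer ℝ N).eval (k + b + c) *
      (ascPochhammer ℝ (N + 1)).eval (b - β) /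
      (N.factorial * (ascPochhammer ℝ (N + 1)).eval b *
        (ascPochhammer ℝ (N + 1)).eval (b + c - β)) := by
  have hK : k + b + c - 1 + 1 = k + b + c := by ring
  induction N with
  | zero => simp; field_simp; ring
  | succ N ih =>
    rw [Finset.sum_range_succ, ih]
    have h1 : (ascPochhammer ℝ N).eval (b + 1) ≠ 0 := (ascPochhammer_pos N _ (by linarith)).ne'
    have h2 : (ascPochhammer ℝ N).eval (b + c - β + 1) ≠ 0 :=
      (ascPochhammer_pos N _ (by linarith)).ne'
    have h3 : b + 1 + N ≠ 0 := by positivity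
    have h4 : b + c - β + 1 + N ≠ 0 := by positivity
    -- Everything is expressed through five symbols of length `N`, so that the induction step
    -- becomes a rational identity.
    rw [ascPochhammer_eval_succ_left (N + 1) b, ascPochhammer_eval_succ_left (N + 1) (b + c - β),
      ascPochhammer_eval_succ_left N b, ascPochhammer_eval_succ_left N (b + c - β),
      ascPochhammer_eval_succ_left N (-k), ascPochhammer_eval_succ_left N (k + b + c - 1), hK,
      ascPochhammer_succ_eval (N + 1) (b - β)]
    simp only [ascPochhammer_succ_eval, Nat.factorial_succ]
    generalize (ascPochhammer ℝ N).eval (b + 1) = x1 at *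
    generalize (ascPochhammer ℝ N).eval (b + c - β + 1) = x2 at *
    generalize (ascPochhammer ℝ N).eval (-k + 1) = x3 at *
    generalize (ascPochhammer ℝ N).eval (k + b + c) = x4 at *
    generalize (ascPochhammer ℝ N).eval (b - β) = x5 at *
    have h5 : (N.factorial : ℝ) ≠ 0 := by positivity
    have h6 := hb.ne'
    have h7 := hd.ne'
    have h8 : (N + 1 : ℝ) ≠ 0 := by positivity
    push_cast
    generalize (N.factorial : ℝ) = x6 at *
    generalize (N : ℝ) = n at *
    clear ih
    field_simp
    ring

/-- The Pfaff–Saalschütz theorem. -/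
theorem pfaff_saalschutz (k : ℕ) (b c β : ℝ) (hb : 0 < b) (hd : 0 < b + c - β) :
    ∑ s ∈ Finset.range (k + 1),
      (ascPochhammer ℝ s).eval (-(k : ℝ)) * (ascPochhammer ℝ s).eval (k + b + c - 1) *
          (ascPochhammer ℝ s).eval (b - β) /
        (s.factorial * (ascPochhammer ℝ s).eval b * (ascPochhammer ℝ s).eval (b + c - β)) =
    (ascPochhammer ℝ k).eval c * (ascPochhammer ℝ k).eval β /
      ((ascPochhammer ℝ k).eval b * (ascPochhammer ℝ k).eval (b + c - β)) := by
  induction k generalizing b c β with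
  | zero => simp
  | succ k ih =>
    have h := saalschutz_telescope ((k + 1 : ℕ) : ℝ) b c β hb hd (k + 1)
    -- The boundary term of the telescoped sum vanishes, so the sum at `k + 1` is a multiple of the
    -- sum at `k` with `b`, `c`, `β` all raised by one.
    have h0 : (ascPochhammer ℝ (k + 1)).eval (-((k + 1 : ℕ) : ℝ) + 1) = 0 :=
      (ascPochhammer_eval_eq_zero_iff _ _).2 ⟨k, by omega, by push_cast; ring⟩
    rw [h0, mul_zero, zero_mul, zero_mul, zero_div, Finset.sum_sub_distrib, sub_eq_zero,
      ← Finset.mul_sum] at h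
    rw [h, Finset.sum_range_succ, h0]
    have ih' := ih (b + 1) (c + 1) (β + 1) (by linarith) (by linarith)
    have e1 : -((k + 1 : ℕ) : ℝ) + 1 = -(k : ℝ) := by push_cast; ring
    have e2 : (k : ℝ) + (b + 1) + (c + 1) - 1 = ((k + 1 : ℕ) : ℝ) + b + c := by push_cast; ring
    have e3 : b + 1 - (β + 1) = b - β := by ring
    have e4 : b + 1 + (c + 1) - (β + 1) = b + c - β + 1 := by ring
    rw [e2, e3, e4] at ih'
    rw [e1, ih']
    simp only [ascPochhammer_eval_succ_left k]
    have h1 : (ascPochhammer ℝ k).eval (b + 1) ≠ 0 := (ascPochhammer_pos k _ (by linarith)).ne'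
    have h2 : (ascPochhammer ℝ k).eval (b + c - β + 1) ≠ 0 :=
      (ascPochhammer_pos k _ (by linarith)).ne'
    simp only [zero_mul, zero_div, add_zero]
    field_simp

/-! ### Radial moments of Jacobi polynomials. -/

theorem jacobiP_one_sub_two_mul (k : ℕ) (α β t : ℝ) :
    jacobiP k α β (1 - 2 * t) = ∑ s ∈ Finset.range (k + 1),
      (ascPochhammer ℝ k).eval (α + 1) / k.factorial *
        ((ascPochhammer ℝ s).eval (-(k : ℝ)) * (ascPochhammer ℝ s).eval (k + α + β + 1) /
          (s.factorial * (ascPochhammer ℝ s).eval (α + 1))) * t ^ s := by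
  have ht : (1 - (1 - 2 * t)) / 2 = t := by ring
  rw [jacobiP, ht, ordinaryHypergeometric_eq_tsum]
  simp only [smul_eq_mul]
  rw [tsum_eq_sum (s := Finset.range (k + 1)), Finset.mul_sum]
  · refine Finset.sum_congr rfl fun s _ => ?_
    rw [div_eq_mul_inv (_ * _) ((s.factorial : ℝ) * _), mul_inv]
    ring
  · intro s hs
    have : (ascPochhammer ℝ s).eval (-(k : ℝ)) = 0 :=
      (ascPochhammer_eval_eq_zero_iff _ _).2 ⟨k, by simpa using hs, by simp⟩
    simp [this]

theorem Real.Gamma_add_nat_eq_ascPochhammer_mul (x : ℝ) (hx : 0 < x) (s : ℕ) :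
    Real.Gamma (x + s) = (ascPochhammer ℝ s).eval x * Real.Gamma x := by
  induction s with
  | zero => simp
  | succ s ih =>
    rw [Nat.cast_succ, ← add_assoc, Real.Gamma_add_one (by positivity), ih,
      ascPochhammer_succ_eval]
    ring

theorem image_sq_Ioo_zero_one : (fun r : ℝ => r ^ 2) '' Ioo 0 1 = Ioo 0 1 := by
  ext t
  constructor
  · rintro ⟨r, hr, rfl⟩
    exact ⟨pow_pos hr.1 2, pow_lt_one₀ hr.1.le hr.2 two_ne_zero⟩
  · rintro ht
    exact ⟨√t, ⟨Real.sqrt_pos.2 ht.1, by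
      rw [Real.sqrt_lt' one_pos]; simpa using ht.2⟩, Real.sq_sqrt ht.1.le⟩

theorem injOn_sq_Ioo_zero_one : InjOn (fun r : ℝ => r ^ 2) (Ioo 0 1) := fun _ hx _ hy h =>
  (pow_left_inj₀ hx.1.le hy.1.le two_ne_zero).1 h

theorem integrableOn_one_sub_rpow (ν : ℝ) (hν : -1 < ν) :
    IntegrableOn (fun t : ℝ => (1 - t) ^ ν) (Ioo 0 1) := by
  have h := (intervalIntegral.intervalIntegrable_rpow' (a := 0) (b := 1) hν).comp_sub_left 1
  simp only [sub_zero, sub_self] at h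
  exact (intervalIntegrable_iff_integrableOn_Ioo_of_le zero_le_one).1 h.symm

theorem integrableOn_mul_one_sub_sq_rpow (ν : ℝ) (hν : -1 < ν) :
    IntegrableOn (fun r : ℝ => r * (1 - r ^ 2) ^ ν) (Ioo 0 1) := by
  have h := integrableOn_one_sub_rpow ν hν
  rw [← image_sq_Ioo_zero_one, integrableOn_image_iff_integrableOn_abs_deriv_smul
    measurableSet_Ioo (fun x _ => (hasDerivAt_pow 2 x).hasDerivWithinAt)
    injOn_sq_Ioo_zero_one] at h
  refine IntegrableOn.congr_fun (Integrable.const_mul h (1 / 2)) (fun r hr => ?_) measurableSet_Ioo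
  have : |(2 : ℝ) * r| = 2 * r := abs_of_pos (by linarith [hr.1])
  simp [this]
  ring

theorem integral_pow_mul_one_sub_rpow (ν : ℝ) (hν : -1 < ν) (N : ℕ) :
    ∫ t in Ioo (0 : ℝ) 1, t ^ N * (1 - t) ^ ν =
      N.factorial * Real.Gamma (ν + 1) / Real.Gamma (N + ν + 2) := by
  have h := Complex.betaIntegral_eq_Gamma_mul_div ((N : ℝ) + 1 : ℝ) ((ν + 1 : ℝ))
    (by simp; positivity) (by simp; linarith)
  rw [← Complex.ofReal_add, Complex.Gamma_ofReal, Complex.Gamma_ofReal, Complex.Gamma_ofReal,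
    Real.Gamma_nat_eq_factorial, Complex.betaIntegral,
    intervalIntegral.integral_of_le zero_le_one, integral_Ioc_eq_integral_Ioo] at h
  rw [← Complex.ofReal_inj, ← integral_complex_ofReal]
  push_cast at h ⊢
  rw [show (N : ℝ) + ν + 2 = N + 1 + (ν + 1) by ring, ← h]
  refine setIntegral_congr_fun measurableSet_Ioo fun t ht => ?_
  simp only [add_sub_cancel_right, Complex.cpow_natCast]
  rw [← Complex.ofReal_one, ← Complex.ofReal_sub, Complex.ofReal_cpow (by linarith [ht.2])]

theorem integral_pow_mul_one_sub_sq_rpow (ν : ℝ) (hν : -1 < ν) (N : ℕ) :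
    ∫ r in Ioo (0 : ℝ) 1, r ^ (2 * N) * (r * (1 - r ^ 2) ^ ν) =
      N.factorial * Real.Gamma (ν + 1) / Real.Gamma (N + ν + 2) / 2 := by
  rw [← integral_pow_mul_one_sub_rpow ν hν N]
  nth_rewrite 2 [← image_sq_Ioo_zero_one]
  rw [integral_image_eq_integral_abs_deriv_smul measurableSet_Ioo
    (fun x _ => (hasDerivAt_pow 2 x).hasDerivWithinAt) injOn_sq_Ioo_zero_one, ← integral_div]
  refine setIntegral_congr_fun measurableSet_Ioo fun r hr => ?_
  have : |(2 : ℝ) * r| = 2 * r := abs_of_pos (by linarith [hr.1])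
  simp [this, pow_mul]
  ring

/-- The moments of the Jacobi polynomials on the unit interval, in the radial variable. -/
theorem integral_pow_mul_jacobiP (ν : ℝ) (hν : -1 < ν) (k a j : ℕ) :
    ∫ r in Ioo (0 : ℝ) 1, r ^ (2 * (a + j)) * jacobiP k a ν (1 - 2 * r ^ 2) *
        (r * (1 - r ^ 2) ^ ν) =
      (ascPochhammer ℝ k).eval (ν + 1) * (ascPochhammer ℝ k).eval (-(j : ℝ)) / k.factorial *
        ((a + j).factorial * Real.Gamma (ν + 1) / Real.Gamma (a + j + k + ν + 2)) / 2 := by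
  have hx : (0 : ℝ) < a + j + ν + 2 := by
    have : (0 : ℝ) ≤ a + j := by positivity
    linarith
  have ha : (ascPochhammer ℝ k).eval ((a : ℝ) + 1) ≠ 0 :=
    (ascPochhammer_pos k _ (by positivity)).ne'
  have hG := (Real.Gamma_pos_of_pos hx).ne'
  -- With `β = -j`, the symbols of `b - β = a + j + 1` and `b + c - β = a + j + ν + 2` are those
  -- produced by the beta integrals of the monomials.
  have hS := pfaff_saalschutz k (a + 1) (ν + 1) (-j) (by positivity) (by linarith)
  have e1 : (a : ℝ) + 1 + (ν + 1) - -(j : ℝ) = a + j + ν + 2 := by ring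
  have e2 : (a : ℝ) + 1 - -(j : ℝ) = ((a + j : ℕ) : ℝ) + 1 := by push_cast; ring
  have e3 : (k : ℝ) + (a + 1) + (ν + 1) - 1 = k + a + ν + 1 := by ring
  rw [e1, e2, e3] at hS
  have hfac : ∀ s : ℕ, ((a + j + s).factorial : ℝ) =
      (ascPochhammer ℝ s).eval (((a + j : ℕ) : ℝ) + 1) * (a + j).factorial := by
    intro s
    rw [← Real.Gamma_nat_eq_factorial, ← Real.Gamma_nat_eq_factorial,
      ← Real.Gamma_add_nat_eq_ascPochhammer_mul _ (by positivity)]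
    push_cast
    ring_nf
  calc _ = ∫ r in Ioo (0 : ℝ) 1, ∑ s ∈ Finset.range (k + 1),
        (ascPochhammer ℝ k).eval ((a : ℝ) + 1) / k.factorial *
        ((ascPochhammer ℝ s).eval (-(k : ℝ)) * (ascPochhammer ℝ s).eval (k + a + ν + 1) /
          (s.factorial * (ascPochhammer ℝ s).eval ((a : ℝ) + 1))) *
        (r ^ (2 * (a + j + s)) * (r * (1 - r ^ 2) ^ ν)) := by
        refine setIntegral_congr_fun measurableSet_Ioo fun r _ => ?_
        simp only [jacobiP_one_sub_two_mul]
        rw [Finset.mul_sum, Finset.sum_mul]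
        refine Finset.sum_congr rfl fun s _ => ?_
        ring
    _ = ∑ s ∈ Finset.range (k + 1),
        (ascPochhammer ℝ k).eval ((a : ℝ) + 1) / k.factorial *
          ((a + j).factorial * Real.Gamma (ν + 1) / Real.Gamma (a + j + ν + 2)) / 2 *
        ((ascPochhammer ℝ s).eval (-(k : ℝ)) * (ascPochhammer ℝ s).eval (k + a + ν + 1) *
          (ascPochhammer ℝ s).eval (((a + j : ℕ) : ℝ) + 1) /
          (s.factorial * (ascPochhammer ℝ s).eval ((a : ℝ) + 1) *
            (ascPochhammer ℝ s).eval (a + j + ν + 2))) := by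
        rw [integral_finsetSum]
        · refine Finset.sum_congr rfl fun s _ => ?_
          rw [integral_const_mul, integral_pow_mul_one_sub_sq_rpow ν hν, hfac,
            show ((a + j + s : ℕ) : ℝ) + ν + 2 = a + j + ν + 2 + s by push_cast; ring,
            Real.Gamma_add_nat_eq_ascPochhammer_mul _ hx]
          have h1 : (ascPochhammer ℝ s).eval ((a : ℝ) + 1) ≠ 0 :=
            (ascPochhammer_pos s _ (by positivity)).ne'
          have h2 := (ascPochhammer_pos s _ hx).ne'
          field_simp
        · intro s _
          refine Integrable.const_mul ?_ _
          exact (integrableOn_mul_one_sub_sq_rpow ν hν).continuousOn_mul_of_subset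
            (by fun_prop) isCompact_Icc measurableSet_Ioo Ioo_subset_Icc_self
    _ = _ := by
        rw [← Finset.mul_sum, hS,
          show (a : ℝ) + j + k + ν + 2 = a + j + ν + 2 + k by ring,
          Real.Gamma_add_nat_eq_ascPochhammer_mul _ hx]
        have h2 := (ascPochhammer_pos k _ hx).ne'
        field_simp

theorem ascPochhammer_eval_neg_nat_add (k q : ℕ) :
    (ascPochhammer ℝ k).eval (-((k + q : ℕ) : ℝ)) * q.factorial =
      (-1) ^ k * (k + q).factorial := by
  rw [ascPochhammer_eval_neg_eq_descPochhammer, descPochhammer_eval_eq_descFactorial, mul_assoc,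
    ← Nat.cast_mul, mul_comm _ q.factorial]
  congr 2
  simpa using Nat.factorial_mul_descFactorial (Nat.le_add_right k q)

/-! ### Angular integrals. -/

open Real in
theorem integral_exp_int_mul_I (l : ℤ) :
    ∫ θ in Set.Ioo (-π) π, Complex.exp (Complex.I * l * (θ : ℂ)) = if l = 0 then 2 * (π : ℂ) else 0 := by
  rw [← MeasureTheory.integral_Ioc_eq_integral_Ioo,
    ← intervalIntegral.integral_of_le (by linarith [pi_pos])]
  split_ifs with h
  · subst h
    simp
    ring
  · have h' : Complex.I * (l : ℂ) ≠ 0 := by simp [h]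
    rw [integral_exp_mul_complex h']
    have : Complex.exp (Complex.I * l * (π : ℂ)) = Complex.exp (Complex.I * l * ((-π : ℝ) : ℂ)) := by
      rw [Complex.exp_eq_exp_iff_exists_int]
      exact ⟨l, by push_cast; ring⟩
    rw [this, sub_self, zero_div]

-- Binomial expansion of `((e^{iφ} + e^{-iφ}) / 2)^p` at `φ = θ - ϑ`: each summand is a constant
-- times one character of `θ`.
open Real in
theorem exp_mul_cos_pow (l : ℤ) (p : ℕ) (θ ϑ : ℝ) :
    Complex.exp (Complex.I * l * (θ : ℂ)) * ((Real.cos (θ - ϑ) ^ p : ℝ) : ℂ) =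
      ∑ q ∈ Finset.range (p + 1), ((p.choose q : ℂ) / 2 ^ p *
        Complex.exp (Complex.I * (p - 2 * q : ℤ) * (ϑ : ℂ))) *
        Complex.exp (Complex.I * (l + 2 * q - p : ℤ) * (θ : ℂ)) := by
  push_cast
  rw [Complex.cos, div_pow, add_pow, Finset.sum_div, Finset.mul_sum]
  refine Finset.sum_congr rfl fun q hq => ?_
  have hq' : q ≤ p := by simpa [Nat.lt_succ_iff] using hq
  rw [← Complex.exp_nat_mul, ← Complex.exp_nat_mul, Nat.cast_sub hq']
  have : ∀ a b c d e f g : ℂ, a + b + c = d + e → Complex.exp a *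
      (Complex.exp b * Complex.exp c * f / g) = f / g * Complex.exp d * Complex.exp e := by
    intro a b c d e f g h
    rw [mul_assoc (f / g), ← Complex.exp_add d, ← h, Complex.exp_add, Complex.exp_add]
    ring
  refine this _ _ _ _ _ _ _ ?_
  ring

open Real in
theorem integral_exp_mul_cos_pow (l : ℤ) (p : ℕ) (ϑ : ℝ) :
    ∫ θ in Set.Ioo (-π) π, Complex.exp (Complex.I * l * (θ : ℂ)) * ((Real.cos (θ - ϑ) ^ p : ℝ) : ℂ) =
      ∑ q ∈ Finset.range (p + 1), if l + 2 * q - p = 0 then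
        (p.choose q : ℂ) / 2 ^ p * Complex.exp (Complex.I * l * (ϑ : ℂ)) * (2 * (π : ℂ)) else 0 := by
  simp_rw [exp_mul_cos_pow]
  rw [MeasureTheory.integral_finsetSum]
  · refine Finset.sum_congr rfl fun q _ => ?_
    rw [MeasureTheory.integral_const_mul, integral_exp_int_mul_I]
    split_ifs with h
    · have : (p - 2 * q : ℤ) = l := by linarith
      rw [this]
    · simp
  · intro q _
    exact ((by fun_prop : Continuous fun θ : ℝ => _).integrableOn_Icc).mono_set
      Set.Ioo_subset_Icc_self

open Real in
theorem integral_exp_mul_cos_pow_eq_zero (l : ℤ) (p : ℕ) (ϑ : ℝ)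
    (h : ∀ j : ℕ, p ≠ l.natAbs + 2 * j) :
    ∫ θ in Set.Ioo (-π) π, Complex.exp (Complex.I * l * (θ : ℂ)) *
      ((Real.cos (θ - ϑ) ^ p : ℝ) : ℂ) = 0 := by
  rw [integral_exp_mul_cos_pow]
  refine Finset.sum_eq_zero fun q hq => if_neg fun hl => ?_
  have hq' : q ≤ p := by simpa [Nat.lt_succ_iff] using hq
  rcases le_total 0 l with h0 | h0
  · exact h q (by omega)
  · exact h (p - q) (by omega)

open Real in
theorem integral_exp_mul_cos_pow_natAbs (l : ℤ) (j : ℕ) (ϑ : ℝ) :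
    ∫ θ in Set.Ioo (-π) π, Complex.exp (Complex.I * l * (θ : ℂ)) *
      ((Real.cos (θ - ϑ) ^ (l.natAbs + 2 * j) : ℝ) : ℂ) =
      ((l.natAbs + 2 * j).choose j : ℂ) / 2 ^ (l.natAbs + 2 * j) *
        Complex.exp (Complex.I * l * (ϑ : ℂ)) * (2 * (π : ℂ)) := by
  rw [integral_exp_mul_cos_pow]
  rcases le_total 0 l with h0 | h0
  · rw [Finset.sum_eq_single j, if_pos (by omega)]
    · intro q _ hq
      exact if_neg (by omega)
    · intro hj
      simp at hj
      omega
  -- For `l ≤ 0` the surviving index is `|l| + j` instead of `j`; the binomial coefficients agree by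
  -- symmetry.
  · rw [Finset.sum_eq_single (l.natAbs + j), if_pos (by omega),
      Nat.choose_symm_of_eq_add (show l.natAbs + 2 * j = l.natAbs + j + j by ring)]
    · intro q _ hq
      exact if_neg (by omega)
    · intro hj
      simp at hj
      omega

/-! ### Polar coordinates in the plane. -/

theorem EuclideanSpace.norm_polar (r θ : ℝ) (hr : 0 ≤ r) :
    ‖(!₂[r * Real.cos θ, r * Real.sin θ] : EuclideanSpace ℝ (Fin 2))‖ = r := by
  rw [EuclideanSpace.norm_eq, Real.sqrt_eq_iff_mul_self_eq (by positivity) hr]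
  simp only [Fin.sum_univ_two, Real.norm_eq_abs, sq_abs]
  simp
  nlinarith [Real.sin_sq_add_cos_sq θ]

theorem EuclideanSpace.inner_polar (r θ ρ ϑ : ℝ) :
    inner ℝ (!₂[r * Real.cos θ, r * Real.sin θ] : EuclideanSpace ℝ (Fin 2))
      !₂[ρ * Real.cos ϑ, ρ * Real.sin ϑ] = r * ρ * Real.cos (θ - ϑ) := by
  simp [PiLp.inner_apply, Fin.sum_univ_two, Real.cos_sub]
  ring

theorem EuclideanSpace.integral_comp_polar {E : Type*} [NormedAddCommGroup E] [NormedSpace ℝ E]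
    (f : EuclideanSpace ℝ (Fin 2) → E) :
    ∫ p in polarCoord.target, p.1 • f !₂[p.1 * Real.cos p.2, p.1 * Real.sin p.2] = ∫ x, f x := by
  have h1 := (EuclideanSpace.volume_preserving_symm_measurableEquiv_toLp (Fin 2)).symm.integral_comp
    (MeasurableEquiv.measurableEmbedding _) f
  have h2 := (volume_preserving_finTwoArrow ℝ).symm.integral_comp
    (MeasurableEquiv.measurableEmbedding _) (fun v => f (WithLp.toLp 2 v))
  rw [← h1]
  refine Eq.trans ?_ h2
  rw [← integral_comp_polarCoord_symm]
  rfl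

/-- No integrability is needed: the polar change of variables and the product formula also hold for
the default value 0. The Jacobian `r` is absorbed in `R`. -/
theorem integral_ball_eq_of_polar_separable (f : EuclideanSpace ℝ (Fin 2) → ℂ) (R A : ℝ → ℂ)
    (h : ∀ r ∈ Ioo (0 : ℝ) 1, ∀ θ : ℝ, r • f !₂[r * Real.cos θ, r * Real.sin θ] = R r * A θ) :
    ∫ x in Metric.ball (0 : EuclideanSpace ℝ (Fin 2)) 1, f x =
      (∫ r in Ioo (0 : ℝ) 1, R r) * ∫ θ in Ioo (-Real.pi) Real.pi, A θ := by
  rw [← integral_indicator Metric.isOpen_ball.measurableSet, ← EuclideanSpace.integral_comp_polar]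
  calc _ = ∫ p in Ioi (0 : ℝ) ×ˢ Ioo (-Real.pi) Real.pi, (Ioo 0 1).indicator R p.1 * A p.2 := by
        refine setIntegral_congr_fun (measurableSet_Ioi.prod measurableSet_Ioo) fun p hp => ?_
        have hp0 : 0 < p.1 := hp.1
        have hn := EuclideanSpace.norm_polar p.1 p.2 hp0.le
        by_cases h1 : p.1 < 1
        · rw [indicator_of_mem (show p.1 ∈ Ioo (0 : ℝ) 1 from ⟨hp0, h1⟩), ← h p.1 ⟨hp0, h1⟩,
            indicator_of_mem]
          rwa [mem_ball_zero_iff, hn]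
        · rw [indicator_of_notMem (fun hm : p.1 ∈ Ioo (0 : ℝ) 1 => h1 hm.2), indicator_of_notMem,
            smul_zero, zero_mul]
          rwa [mem_ball_zero_iff, hn]
    _ = _ := by
        rw [Measure.volume_eq_prod, setIntegral_prod_mul, setIntegral_indicator measurableSet_Ioo,
          inter_eq_self_of_subset_right Ioo_subset_Ioi_self]

/-! ### Measurability and integrability. -/

theorem measurable_polarAngle : Measurable polarAngle := by
  unfold polarAngle
  fun_prop

theorem continuous_jacobiP_one_sub (k : ℕ) (α β : ℝ) :
    Continuous fun r : ℝ => jacobiP k α β (1 - 2 * r ^ 2) := by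
  simp only [jacobiP_one_sub_two_mul]
  fun_prop

theorem measurable_diskPoly (ν : ℝ) (m n : ℕ) : Measurable (diskPoly ν m n) := by
  have h1 := measurable_polarAngle
  have h2 : Measurable fun x : EuclideanSpace ℝ (Fin 2) =>
      jacobiP (min m n) (((m : ℤ) - (n : ℤ)).natAbs : ℝ) ν (1 - 2 * ‖x‖ ^ 2) :=
    ((continuous_jacobiP_one_sub _ _ _).comp continuous_norm).measurable
  unfold diskPoly
  fun_prop

theorem measurable_diskWeight (ν : ℝ) : Measurable (diskWeight ν) := by
  unfold diskWeight
  fun_prop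

theorem norm_diskPoly (ν : ℝ) (m n : ℕ) (x : EuclideanSpace ℝ (Fin 2)) :
    ‖diskPoly ν m n x‖ =
      ‖(-1 : ℝ) ^ min m n * ((min m n).factorial : ℝ) / (ascPochhammer ℝ (min m n)).eval (ν + 1)‖ *
      ‖‖x‖ ^ ((m : ℤ) - (n : ℤ)).natAbs *
        jacobiP (min m n) (((m : ℤ) - (n : ℤ)).natAbs : ℝ) ν (1 - 2 * ‖x‖ ^ 2)‖ := by
  unfold diskPoly
  rw [norm_mul, norm_mul, Complex.norm_real, Complex.norm_real]
  have : Complex.I * ((m : ℂ) - (n : ℂ)) * (polarAngle x : ℂ) =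
      (((m : ℝ) - n) * polarAngle x : ℝ) * Complex.I := by
    push_cast
    ring
  rw [this, Complex.norm_exp_ofReal_mul_I, mul_one]

/-- The absolute value is radial, which reduces the claim to a continuous factor times `r (1 -
r²)^ν` on `(0, 1)`; `ν > -1` controls the boundary. -/
theorem integrableOn_diskPoly_mul_diskWeight (ν : ℝ) (hν : -1 < ν) (m n : ℕ) :
    IntegrableOn (fun x => diskPoly ν m n x * (diskWeight ν x : ℂ)) (Metric.ball 0 1) := by
  set a := ((m : ℤ) - (n : ℤ)).natAbs with ha
  obtain ⟨C, hC⟩ : ∃ C, C = ‖(-1 : ℝ) ^ min m n * ((min m n).factorial : ℝ) /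
    (ascPochhammer ℝ (min m n)).eval (ν + 1)‖ := ⟨_, rfl⟩
  have hg : IntegrableOn (fun x : EuclideanSpace ℝ (Fin 2) =>
      C * (‖x‖ ^ a * jacobiP (min m n) a ν (1 - 2 * ‖x‖ ^ 2)) *
        ((ν + 1) / Real.pi * (1 - ‖x‖ ^ 2) ^ ν)) (Metric.ball 0 1) := by
    refine (integrableOn_fun_norm_addHaar volume (f := fun r : ℝ =>
      C * (r ^ a * jacobiP (min m n) a ν (1 - 2 * r ^ 2)) *
        ((ν + 1) / Real.pi * (1 - r ^ 2) ^ ν))).2 ?_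
    have hc := continuous_jacobiP_one_sub (min m n) a ν
    refine ((integrableOn_mul_one_sub_sq_rpow ν hν).continuousOn_mul_of_subset
      (K := Icc 0 1)
      (g := fun r : ℝ => C * (r ^ a * jacobiP (min m n) a ν (1 - 2 * r ^ 2)) *
        ((ν + 1) / Real.pi)) (by fun_prop) isCompact_Icc measurableSet_Ioo
      Ioo_subset_Icc_self).congr_fun (fun r _ => ?_) measurableSet_Ioo
    simp
    ring
  refine Integrable.mono hg ?_ (.of_forall fun x => ?_)
  · exact ((measurable_diskPoly ν m n).mul
      (Complex.measurable_ofReal.comp (measurable_diskWeight ν))).aestronglyMeasurable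
  · rw [norm_mul, norm_diskPoly, Complex.norm_real, diskWeight, ← hC, ← ha, norm_mul (C * _),
      norm_mul C, hC, norm_norm]

/-- One term of the exponential series of the plane wave against a disk polynomial. -/
noncomputable def diskTerm (ν : ℝ) (m n : ℕ) (y : EuclideanSpace ℝ (Fin 2)) (p : ℕ)
    (x : EuclideanSpace ℝ (Fin 2)) : ℂ :=
  (Complex.I * (inner ℝ x y : ℝ)) ^ p / p.factorial * (diskPoly ν m n x * (diskWeight ν x : ℂ))

theorem hasSum_integral_diskTerm (ν : ℝ) (hν : -1 < ν) (m n : ℕ)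
    (y : EuclideanSpace ℝ (Fin 2)) :
    HasSum (fun p => ∫ x in Metric.ball 0 1, diskTerm ν m n y p x)
      (∫ x in Metric.ball 0 1, diskPoly ν m n x * Complex.exp (Complex.I * (inner ℝ x y : ℝ)) *
        (diskWeight ν x : ℂ)) := by
  have hi := integrableOn_diskPoly_mul_diskWeight ν hν m n
  refine hasSum_integral_of_dominated_convergence
    -- On the disk `|⟨x, y⟩| ≤ ‖y‖`, and these bounds sum to a constant multiple of an integrable
    -- function.
    (fun p x => ‖y‖ ^ p / p.factorial * ‖diskPoly ν m n x * (diskWeight ν x : ℂ)‖) ?_ ?_ ?_ ?_ ?_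
  · intro p
    exact (by fun_prop : Continuous fun x : EuclideanSpace ℝ (Fin 2) =>
      (Complex.I * (inner ℝ x y : ℝ)) ^ p / p.factorial).aestronglyMeasurable.mul
        hi.aestronglyMeasurable
  · intro p
    filter_upwards [ae_restrict_mem Metric.isOpen_ball.measurableSet] with x hx
    rw [diskTerm, norm_mul, norm_div, norm_pow, norm_mul, Complex.norm_I, one_mul,
      Complex.norm_real, Complex.norm_natCast]
    gcongr
    refine (norm_inner_le_norm x y).trans ?_
    exact mul_le_of_le_one_left (norm_nonneg _) (mem_ball_zero_iff.1 hx).le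
  · exact .of_forall fun x => (Real.summable_pow_div_factorial ‖y‖).mul_right _
  · simp_rw [tsum_mul_right]
    exact hi.norm.const_mul _
  · refine .of_forall fun x => ?_
    have h := (NormedSpace.expSeries_div_hasSum_exp (𝔸 := ℂ)
      (Complex.I * (inner ℝ x y : ℝ))).mul_right (diskPoly ν m n x * (diskWeight ν x : ℂ))
    rw [← Complex.exp_eq_exp_ℂ] at h
    rw [show ∀ a b c : ℂ, a * b * c = b * (a * c) from fun a b c => by ring]
    exact h

theorem integrableOn_diskPoly_mul_exp_mul_diskWeight (ν : ℝ) (hν : -1 < ν) (m n : ℕ)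
    (y : EuclideanSpace ℝ (Fin 2)) :
    IntegrableOn (fun x => diskPoly ν m n x * Complex.exp (Complex.I * (inner ℝ x y : ℝ)) *
      (diskWeight ν x : ℂ)) (Metric.ball 0 1) := by
  have h := (integrableOn_diskPoly_mul_diskWeight ν hν m n).bdd_mul (c := 1)
    (f := fun x => Complex.exp (Complex.I * (inner ℝ x y : ℝ)))
    (by fun_prop : Continuous fun x : EuclideanSpace ℝ (Fin 2) =>
      Complex.exp (Complex.I * (inner ℝ x y : ℝ))).aestronglyMeasurable
    (.of_forall fun x => by rw [mul_comm Complex.I, Complex.norm_exp_ofReal_mul_I])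
  refine h.congr (.of_forall fun x => ?_)
  simp only
  ring

/-! ### Evaluation of the terms of the series. -/

theorem integral_diskTerm (ν : ℝ) (m n p : ℕ) (ρ ϑ : ℝ) :
    ∫ x in Metric.ball 0 1, diskTerm ν m n !₂[ρ * Real.cos ϑ, ρ * Real.sin ϑ] p x =
      (((-1 : ℝ) ^ min m n * ((min m n).factorial : ℝ) / (ascPochhammer ℝ (min m n)).eval (ν + 1) *
        ((ν + 1) / Real.pi) : ℝ) : ℂ) * ((Complex.I * ρ) ^ p / p.factorial) *
      ((∫ r in Ioo (0 : ℝ) 1, r ^ (((m : ℤ) - (n : ℤ)).natAbs + p) *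
        jacobiP (min m n) (((m : ℤ) - (n : ℤ)).natAbs : ℝ) ν (1 - 2 * r ^ 2) *
        (r * (1 - r ^ 2) ^ ν) : ℝ) : ℂ) *
      ∫ θ in Ioo (-Real.pi) Real.pi, Complex.exp (Complex.I * ((m : ℤ) - (n : ℤ) : ℤ) * (θ : ℂ)) *
        ((Real.cos (θ - ϑ) ^ p : ℝ) : ℂ) := by
  rw [← integral_complex_ofReal, ← integral_const_mul (L := ℂ) (μ := volume.restrict (Ioo 0 1))]
  refine integral_ball_eq_of_polar_separable _ _ _ fun r hr θ => ?_
  rw [diskTerm, diskPoly_polar _ _ _ _ _ hr.1.le, diskWeight, EuclideanSpace.inner_polar,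
    EuclideanSpace.norm_polar _ _ hr.1.le, Complex.real_smul]
  push_cast
  ring

theorem integral_diskTerm_eq_zero (ν : ℝ) (hν : -1 < ν) (m n p : ℕ) (ρ ϑ : ℝ)
    (hp : ∀ q : ℕ, p ≠ m + n + 2 * q) :
    ∫ x in Metric.ball 0 1, diskTerm ν m n !₂[ρ * Real.cos ϑ, ρ * Real.sin ϑ] p x = 0 := by
  rw [integral_diskTerm]
  by_cases h : ∃ j : ℕ, p = ((m : ℤ) - (n : ℤ)).natAbs + 2 * j
  · obtain ⟨j, rfl⟩ := h
    have hj : j < min m n := by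
      by_contra hj
      exact hp (j - min m n) (by omega)
    have h0 : (ascPochhammer ℝ (min m n)).eval (-(j : ℝ)) = 0 :=
      (ascPochhammer_eval_eq_zero_iff _ _).2 ⟨j, hj, by simp⟩
    rw [show ((m : ℤ) - (n : ℤ)).natAbs + (((m : ℤ) - (n : ℤ)).natAbs + 2 * j) =
      2 * (((m : ℤ) - (n : ℤ)).natAbs + j) by ring, integral_pow_mul_jacobiP ν hν, h0]
    simp
  · rw [integral_exp_mul_cos_pow_eq_zero _ _ _ (not_exists.1 h), mul_zero]

theorem integral_diskTerm_add (ν : ℝ) (hν : -1 < ν) (m n q : ℕ) (ρ ϑ : ℝ) :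
    ∫ x in Metric.ball 0 1,
      diskTerm ν m n !₂[ρ * Real.cos ϑ, ρ * Real.sin ϑ] (m + n + 2 * q) x =
      diskConst ν m n * (((-1) ^ q / (q.factorial * Real.Gamma (ν + n + m + 1 + q + 1)) *
        (ρ / 2) ^ (m + n + 2 * q) : ℝ) : ℂ) *
        Complex.exp (Complex.I * ((m : ℂ) - (n : ℂ)) * (ϑ : ℂ)) := by
  have hI : Complex.I ^ (m + n + 2 * q) =
      (-1 : ℂ) ^ m * Complex.I ^ ((n : ℤ) - (m : ℤ)) * (-1) ^ q := by
    rw [← Complex.I_sq, ← pow_mul, ← pow_mul, ← zpow_natCast, ← zpow_natCast Complex.I (2 * m),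
      ← zpow_natCast Complex.I (2 * q), ← zpow_add₀ Complex.I_ne_zero,
      ← zpow_add₀ Complex.I_ne_zero]
    congr 1
    push_cast
    ring
  rw [integral_diskTerm, mul_pow, hI, diskConst]
  set a := ((m : ℤ) - (n : ℤ)).natAbs with ha
  set k := min m n with hk
  -- The surviving exponents correspond to `j = k + q` in the angular and radial formulas.
  have hp : m + n + 2 * q = a + 2 * (k + q) := by omega
  have hG : (a : ℝ) + (k + q : ℕ) + k + ν + 2 = ν + n + m + 1 + q + 1 := by
    have h : ((m + n : ℕ) : ℝ) = ((a + 2 * k : ℕ) : ℝ) := congrArg _ (by omega)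
    push_cast at h ⊢
    linarith
  rw [hp, integral_exp_mul_cos_pow_natAbs, ← ha,
    show a + (a + 2 * (k + q)) = 2 * (a + (k + q)) by ring, integral_pow_mul_jacobiP ν hν, hG]
  have hneg : (ascPochhammer ℝ k).eval (-((k + q : ℕ) : ℝ)) =
      (-1) ^ k * (k + q).factorial / q.factorial := by
    rw [eq_div_iff (by positivity), ascPochhammer_eval_neg_nat_add]
  have hch : ((a + 2 * (k + q)).choose (k + q) : ℝ) =
      (a + 2 * (k + q)).factorial / ((k + q).factorial * (a + (k + q)).factorial) := by
    rw [Nat.cast_choose ℝ (by omega)]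
    congr 4
    omega
  have hν' : (ascPochhammer ℝ k).eval (ν + 1) ≠ 0 := (ascPochhammer_pos k _ (by linarith)).ne'
  -- One sign `(-1)^k` comes from the normalization of the disk polynomial, the other from `(-(k +
  -- q))_k`.
  have hsign : ((-1 : ℝ) ^ k) ^ 2 = 1 := by rw [← pow_mul, mul_comm, pow_mul]; simp
  have key : (-1 : ℝ) ^ k * (k.factorial : ℝ) / (ascPochhammer ℝ k).eval (ν + 1) *
        ((ν + 1) / Real.pi) * (ρ ^ (a + 2 * (k + q)) / (a + 2 * (k + q)).factorial) *
      ((ascPochhammer ℝ k).eval (ν + 1) * (ascPochhammer ℝ k).eval (-((k + q : ℕ) : ℝ)) /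
        k.factorial * ((a + (k + q)).factorial * Real.Gamma (ν + 1) /
          Real.Gamma (ν + n + m + 1 + q + 1)) / 2) *
      (((a + 2 * (k + q)).choose (k + q) : ℝ) / 2 ^ (a + 2 * (k + q)) * (2 * Real.pi)) =
      (ν + 1) * Real.Gamma (ν + 1) * (1 / (q.factorial * Real.Gamma (ν + n + m + 1 + q + 1)) *
        (ρ / 2) ^ (a + 2 * (k + q))) := by
    have hΓ : Real.Gamma (ν + n + m + 1 + q + 1) ≠ 0 := by
      refine (Real.Gamma_pos_of_pos ?_).ne'
      have : (0 : ℝ) ≤ n + m + q := by positivity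
      linarith
    rw [hneg, hch, div_pow]
    have := Real.pi_ne_zero
    field_simp
    linear_combination (ν + 1) * Real.Gamma (ν + 1) * ρ ^ (a + 2 * (k + q)) * hsign
  have key' := congrArg (fun t : ℝ => (t : ℂ)) key
  push_cast at key' ⊢
  linear_combination (-1) ^ m * Complex.I ^ ((n : ℤ) - (m : ℤ)) * (-1) ^ q *
    Complex.exp (Complex.I * ((m : ℂ) - (n : ℂ)) * (ϑ : ℂ)) * key'

theorem mainTheorem2 (ν : ℝ) (hν : -1 < ν) (m n : ℕ) (ρ ϑ : ℝ) (hρ : 0 < ρ) :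
    MeasureTheory.IntegrableOn
      (fun x : EuclideanSpace ℝ (Fin 2) => diskPoly ν m n x *
        Complex.exp (Complex.I * (inner ℝ x !₂[ρ * Real.cos ϑ, ρ * Real.sin ϑ] : ℝ)) *
        (diskWeight ν x : ℂ))
      (Metric.ball 0 1) MeasureTheory.volume ∧
    ∫ x in Metric.ball (0 : EuclideanSpace ℝ (Fin 2)) 1, diskPoly ν m n x *
        Complex.exp (Complex.I * (inner ℝ x !₂[ρ * Real.cos ϑ, ρ * Real.sin ϑ] : ℝ)) *
        (diskWeight ν x : ℂ) =
      diskConst ν m n * (((2 / ρ) ^ (ν + 1) * besselJ (ν + n + m + 1) ρ : ℝ) : ℂ) *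
        Complex.exp (Complex.I * ((m : ℂ) - (n : ℂ)) * (ϑ : ℂ)) := by
  refine ⟨integrableOn_diskPoly_mul_exp_mul_diskWeight ν hν m n _, ?_⟩
  have h := hasSum_integral_diskTerm ν hν m n !₂[ρ * Real.cos ϑ, ρ * Real.sin ϑ]
  have hinj : Function.Injective fun q : ℕ => m + n + 2 * q := fun a b hab => by
    simp only at hab
    omega
  rw [← hinj.hasSum_iff fun p hp => integral_diskTerm_eq_zero ν hν m n p ρ ϑ
    fun q hq => hp ⟨q, hq.symm⟩] at h
  rw [← h.tsum_eq]
  simp only [Function.comp_def, integral_diskTerm_add ν hν]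
  rw [tsum_mul_right, tsum_mul_left, ← Complex.ofReal_tsum, besselJ, ← tsum_mul_left]
  congr 3
  refine tsum_congr fun q => ?_
  -- The Bessel term carries the power `2q + ν + n + m + 1`; its excess `ν + 1` is what
  -- `(2/ρ)^(ν+1)` compensates.
  have hpow : (ρ / 2) ^ (m + n + 2 * q) =
      (2 / ρ) ^ (ν + 1) * (ρ / 2) ^ (2 * (q : ℝ) + (ν + n + m + 1)) := by
    rw [← inv_div ρ 2, Real.inv_rpow (by positivity), ← Real.rpow_neg (by positivity),
      ← Real.rpow_add (by positivity), ← Real.rpow_natCast]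
    congr 1
    push_cast
    ring
  rw [hpow]
  ring
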